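/- Let $\Omega=[a,b]\times[c,d]$ and let $a=x_0<x_1<\dots<x_m=b$, $c=y_0<y_1<\dots<y_n=d$ ($m,n\ge 1$) be arbitrary partitions, with double knots $x_{-1}=x_0$, $x_{m+1}=x_m$, $y_{-1}=y_0$, $y_{n+1}=y_n$. For $0\le i\le m+1$, $0\le j\le n+1$ put $h_i=x_i-x_{i-1}$, $k_j=y_j-y_{j-1}$, $s_i=\frac12(x_{i-1}+x_i)$, $t_j=\frac12(y_{j-1}+y_j)$, $M_{i,j}=(s_i,t_j)$, $h=\max\{h_i,k_j\}$, $A_{i,j}=(x_i,y_j)$. For $1\le i\le m+1$ let $\sigma_i=\frac{h_i}{h_{i-1}+h_i}$ and $\sigma_i'=1-\sigma_i$; for $1\le j\le n+1$ let $\tau_j=\frac{k_j}{k_{j-1}+k_j}$ and $\tau_j'=1-\tau_j$. Let $B_{ij}$ be the $C^1$ piecewise quadratic B-splines on the criss-cross triangulation of $\Omega$ (both diagonals drawn in every cell $[x_{r-1},x_r]\times[y_{s-1},y_s]$), with these double knots. Explicitly, let $\beta_i(x_p)=\sigma_{p+1}$ if $i=p$, $\sigma'_{p+1}$ if $i=p+1$,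 and $0$ otherwise ($0\le p\le m$), and define $\gamma_j(y_q)$ in the same way from $\tau,\tau'$. The Bernstein–Bézier coefficients of $B_{ij}$ are: $\beta_i(x_p)\gamma_j(y_q)$ at the vertex $(x_p,y_q)$; $\delta_{ir}\gamma_j(y_q)$ at the midpoint of the edge $[x_{r-1},x_r]\times\{y_q\}$; $\beta_i(x_p)\delta_{js}$ at the midpoint of the edge $\{x_p\}\times[y_{s-1},y_s]$; at the centre of a cell, the mean of the coefficients at the midpoints of its four sides; at the midpoint of a half diagonal joining the centre of a cell to a corner, the mean of the coefficients at the midpoints of the two sides of the cell that meet at this corner. Define the quasi-interpolants $S_2f=\sum_{i=0}^{m+1}\sum_{j=0}^{n+1}\mu_{ij}(f)B_{ij}$ and $W_2^*f=\sum_{i=0}^{m+1}\sum_{j=0}^{n+1}\mu_{ij}^*(f)B_{ij}$ by $$\mu_{ij}(f)=b_{ij}f(M_{i,j})+a_if(M_{i-1,j})+c_if(M_{i+1,j})+\bar a_jf(M_{i,j-1})+\bar c_jf(M_{i,j+1}),$$ $$\mu^*_{ij}(f)=2f(M_{i,j})-\tfrac14\left[f(A_{i-1,j-1})+f(A_{i-1,j})+f(A_{i,j-1})+f(A_{i,j})\right],$$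 where $a_i=-\frac{\sigma_i^2\sigma_{i+1}'}{\sigma_i+\sigma_{i+1}'}$, $c_i=-\frac{\sigma_i(\sigma_{i+1}')^2}{\sigma_i+\sigma_{i+1}'}$ for $1\le i\le m$, $a_0=c_0=a_{m+1}=c_{m+1}=0$ (terms with coefficient $0$ are omitted), $\bar a_j,\bar c_j$ are defined in the same way from $\tau,\tau'$ (and vanish for $j=0,n+1$), and $b_{ij}=1-(a_i+c_i+\bar a_j+\bar c_j)$. For $\psi\in C(\Omega)$ let $\omega(\psi,t)=\max\{|\psi(M)-\psi(P)|:M,P\in\Omega,\ \|M-P\|\le t\}$ with the Euclidean norm, let $\omega(Df,t)=\max\{\omega(\partial f/\partial x,t),\,\omega(\partial f/\partial y,t)\}$, and let $\|\cdot\|_\Omega$ be the supremum norm on $\Omega$. **Theorem (error bounds for $C^1$ functions).** For $Q=S_2$ and for $Q=W_2^*$ there is a constant $C_1>0$, with $C_1\le 3$ for $Q=S_2$ and $C_1\le 2$ for $Q=W_2^*$, such that for all partitions as above and all $f\in C^1(\Omega)$ $$\|f-Qf\|_\Omega\le C_1\,h\,\omega(Df,h/2).$$ -/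

import Mathlib

/-- A partition `a = x 0 < x 1 < ⋯ < x m = b` of the interval `[a, b]` into `m ≥ 1` subintervals.
Only the values `x i` with `i ≤ m` are ever used. -/
structure Knots (a b : ℝ) where
  m : ℕ
  m_pos : 0 < m
  x : ℕ → ℝ
  x_lt : ∀ i, i < m → x i < x (i + 1)
  x_first : x 0 = a
  x_last : x m = b

namespace Knots

noncomputable section

variable {a b : ℝ} (X : Knots a b)

/-- The knot `x_i`, with the double knot `x_{m+1} = x_m` on the right.  The double knot
`x_{-1} = x_0` on the left appears as `X.knot (0 - 1)`, with truncated subtraction in `ℕ`. -/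
def knot (i : ℕ) : ℝ := X.x (min i X.m)

/-- The step `h_i = x_i - x_{i-1}`; it is positive for `1 ≤ i ≤ m`, and `h_0 = h_{m+1} = 0`. -/
def step (i : ℕ) : ℝ := X.knot i - X.knot (i - 1)

/-- The midpoint `s_i = (x_{i-1} + x_i) / 2`; in particular `s_0 = x_0` and `s_{m+1} = x_m`. -/
def mid (i : ℕ) : ℝ := (X.knot (i - 1) + X.knot i) / 2

/-- `σ_i = h_i / (h_{i-1} + h_i)`, meant for `1 ≤ i ≤ m + 1`; so `σ_1 = 1`, `σ_{m+1} = 0`. -/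
def sigma (i : ℕ) : ℝ := X.step i / (X.step (i - 1) + X.step i)

/-- `σ'_i = h_{i-1} / (h_{i-1} + h_i)`, meant for `1 ≤ i ≤ m + 1`; so `σ'_1 = 0`,
`σ'_{m+1} = 1`. -/
def sigma' (i : ℕ) : ℝ := X.step (i - 1) / (X.step (i - 1) + X.step i)

/-- The coefficient `a_i` of the left neighbour in the functionals of `S₂`
(`a_0 = a_{m+1} = 0`). -/
def coefA (i : ℕ) : ℝ :=
  if 1 ≤ i ∧ i ≤ X.m then
    -(X.sigma i ^ 2 * X.sigma' (i + 1)) / (X.sigma i + X.sigma' (i + 1))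
  else 0

/-- The coefficient `c_i` of the right neighbour in the functionals of `S₂`
(`c_0 = c_{m+1} = 0`). -/
def coefC (i : ℕ) : ℝ :=
  if 1 ≤ i ∧ i ≤ X.m then
    -(X.sigma i * X.sigma' (i + 1) ^ 2) / (X.sigma i + X.sigma' (i + 1))
  else 0

/-- The maximal step `max {h_i : 1 ≤ i ≤ m}`. -/
def maxStep : ℝ :=
  (Finset.Icc 1 X.m).sup' (Finset.nonempty_Icc.mpr X.m_pos) X.step

/-- The index `r ∈ {1, …, m}` of a subinterval `[x_{r-1}, x_r]` that contains `t ∈ [a, b]`. -/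
def cell (t : ℝ) : ℕ := ((Finset.range X.m).filter (fun i => X.x i ≤ t)).card

/-- The value at the knot `x_p` (`0 ≤ p ≤ m`) of the `i`-th univariate quadratic B-spline
(`0 ≤ i ≤ m + 1`): it is `σ_{p+1}` for `i = p`, `σ'_{p+1}` for `i = p + 1`, and zero otherwise. -/
def knotValue (i p : ℕ) : ℝ :=
  if i = p then X.sigma (p + 1) else if i = p + 1 then X.sigma' (p + 1) else 0

/-- The middle Bernstein-Bézier coefficient on `[x_{r-1}, x_r]` (`1 ≤ r ≤ m`) of the `i`-th
univariate quadratic B-spline. -/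
def midCoef (i r : ℕ) : ℝ := if i = r then 1 else 0

end

end Knots

noncomputable section

/-- The quadratic polynomial in Bernstein-Bézier form on a triangle: `l₁, l₂, l₃` are the
barycentric coordinates, `v₁, v₂, v₃` the coefficients at the vertices, and `e₁₂, e₁₃, e₂₃`
the coefficients at the midpoints of the edges. -/
def bernsteinBezier (v₁ v₂ v₃ e₁₂ e₁₃ e₂₃ l₁ l₂ l₃ : ℝ) : ℝ :=
  v₁ * l₁ ^ 2 + v₂ * l₂ ^ 2 + v₃ * l₃ ^ 2
    + 2 * e₁₂ * l₁ * l₂ + 2 * e₁₃ * l₁ * l₃ + 2 * e₂₃ * l₂ * l₃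

/-- The closed rectangle `Ω = [a, b] × [c, d]`. -/
def rect (a b c d : ℝ) : Set (ℝ × ℝ) := Set.Icc a b ×ˢ Set.Icc c d

section Spline

variable {a b c d : ℝ} (X : Knots a b) (Y : Knots c d)

/-- The maximal steplength `h = max {h_i, k_j}` of the two partitions. -/
def meshSize : ℝ := max X.maxStep Y.maxStep

/-- The `C¹` quadratic B-spline `B_{ij}` (`0 ≤ i ≤ m + 1`, `0 ≤ j ≤ n + 1`) on the criss-cross
triangulation of `Ω`, with double knots at the boundary, through its Bernstein-Bézier coefficients.

Let the point lie in the cell `[x_{r-1}, x_r] × [y_{s-1}, y_s]`, with local coordinates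
`(u, v) ∈ [0, 1]²`.  The coefficients at the four corners and at the midpoints of the four sides of
the cell are the tensor products of the univariate ones.  The coefficients at the midpoints of the
half diagonals are the averages of those at the midpoints of the two adjacent sides, and the
coefficient at the centre of the cell is the average of those at the midpoints of the four sides
(this makes the function `C¹`). The two diagonals `v = u` and `v = 1 - u` cut the cell into
the four triangles of the triangulation. -/
def bspline (i j : ℕ) (P : ℝ × ℝ) : ℝ :=
  let r := X.cell P.1
  let s := Y.cell P.2
  let u := (P.1 - X.knot (r - 1)) / X.step r
  let v := (P.2 - Y.knot (s - 1)) / Y.step s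
  let cSW := X.knotValue i (r - 1) * Y.knotValue j (s - 1)
  let cSE := X.knotValue i r * Y.knotValue j (s - 1)
  let cNW := X.knotValue i (r - 1) * Y.knotValue j s
  let cNE := X.knotValue i r * Y.knotValue j s
  let cS := Knots.midCoef i r * Y.knotValue j (s - 1)
  let cN := Knots.midCoef i r * Y.knotValue j s
  let cW := X.knotValue i (r - 1) * Knots.midCoef j s
  let cE := X.knotValue i r * Knots.midCoef j s
  let dSW := (cS + cW) / 2
  let dSE := (cS + cE) / 2
  let dNW := (cN + cW) / 2
  let dNE := (cN + cE) / 2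
  let z := (cS + cN + cW + cE) / 4
  if v ≤ u ∧ v ≤ 1 - u then
    bernsteinBezier cSW cSE z cS dSW dSE (1 - u - v) (u - v) (2 * v)
  else if u ≤ v ∧ 1 - u ≤ v then
    bernsteinBezier cNW cNE z cN dNW dNE (v - u) (u + v - 1) (2 * (1 - v))
  else if u ≤ v then
    bernsteinBezier cSW cNW z cW dSW dNW (1 - u - v) (v - u) (2 * u)
  else
    bernsteinBezier cSE cNE z cE dSE dNE (u - v) (u + v - 1) (2 * (1 - u))

/-- The coefficient functional `μ_{ij}(f)` of `S₂`, where `M_{i,j} = (s_i, t_j)`. For `i = 0`,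
`i = m + 1`, `j = 0` or `j = n + 1`, the terms at indices out of range have coefficient zero. -/
def muS (f : ℝ × ℝ → ℝ) (i j : ℕ) : ℝ :=
  (1 - (X.coefA i + X.coefC i + Y.coefA j + Y.coefC j)) * f (X.mid i, Y.mid j)
    + X.coefA i * f (X.mid (i - 1), Y.mid j) + X.coefC i * f (X.mid (i + 1), Y.mid j)
    + Y.coefA j * f (X.mid i, Y.mid (j - 1)) + Y.coefC j * f (X.mid i, Y.mid (j + 1))

/-- The coefficient functional `μ*_{ij}(f)` of `W₂*`. -/
def muW (f : ℝ × ℝ → ℝ) (i j : ℕ) : ℝ :=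
  2 * f (X.mid i, Y.mid j)
    - 1 / 4 * (f (X.knot (i - 1), Y.knot (j - 1)) + f (X.knot (i - 1), Y.knot j)
      + f (X.knot i, Y.knot (j - 1)) + f (X.knot i, Y.knot j))

/-- The quasi-interpolant `S₂ f = ∑ μ_{ij}(f) B_{ij}`. -/
def quasiS (f : ℝ × ℝ → ℝ) (P : ℝ × ℝ) : ℝ :=
  ∑ i ∈ Finset.range (X.m + 2), ∑ j ∈ Finset.range (Y.m + 2), muS X Y f i j * bspline X Y i j P

/-- The modified Chui-Wang quasi-interpolant `W₂* f = ∑ μ*_{ij}(f) B_{ij}`. -/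
def quasiW (f : ℝ × ℝ → ℝ) (P : ℝ × ℝ) : ℝ :=
  ∑ i ∈ Finset.range (X.m + 2), ∑ j ∈ Finset.range (Y.m + 2), muW X Y f i j * bspline X Y i j P

end Spline

/-- The supremum norm `‖g‖_Ω = sup {|g P| : P ∈ Ω}`, for `g` bounded on `Ω`. -/
def supNorm (Ω : Set (ℝ × ℝ)) (g : ℝ × ℝ → ℝ) : ℝ := sSup ((fun P => |g P|) '' Ω)

/-- The modulus of continuity `ω(ψ, t)` on `Ω`, with respect to the Euclidean distance. -/
def modulus (Ω : Set (ℝ × ℝ)) (ψ : ℝ × ℝ → ℝ) (t : ℝ) : ℝ :=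
  sSup {w | ∃ M ∈ Ω, ∃ P ∈ Ω,
    Real.sqrt ((M.1 - P.1) ^ 2 + (M.2 - P.2) ^ 2) ≤ t ∧ w = |ψ M - ψ P|}

/-- `ω(Df, t)`: the larger of the moduli of continuity of the two first partial derivatives of `f`
on `Ω` (one-sided where necessary on the boundary). -/
def modulusD (Ω : Set (ℝ × ℝ)) (f : ℝ × ℝ → ℝ) (t : ℝ) : ℝ :=
  max (modulus Ω (fun P => fderivWithin ℝ f Ω P (1, 0)) t)
    (modulus Ω (fun P => fderivWithin ℝ f Ω P (0, 1)) t)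

end

/-! Write `η = h/2` and let `W` be the modulus of the gradient at distance `η`. The B-splines are
nonnegative, sum to one, and reproduce affine functions from their values at the points `M_ij`.
Hence, with `T` the first-order Taylor polynomial of `f` at `P`, the error `Qf(P) - f(P)` equals `∑
(μ_ij(f) - T(M_ij)) B_ij(P)`, and it suffices to bound `μ_ij(f) - f(M_ij)` and `f(M_ij) - T(M_ij)`.

The first difference is a combination of balanced second differences of `f`, so it is controlled by
the variation of the gradient: at most `2ηW` for `S₂` (`abs_muS_sub_le`) and `ηW` for `W₂*`
(`abs_muW_sub_le`).

For the second, `GradientBound.taylor` gives a remainder quadratic in the distance plus a constant,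
`W (|M - P|²/η + 3η/4)`. This form can be averaged against the B-splines without knowing their
supports: each coordinate has second moment at most `h²/4 = η²` (`Knots.spline_mid_sub_sq_le`),
which yields `(2 + 3/4) ηW`. The moments are univariate, because the criss-cross element has the
quadratic Bernstein polynomials as marginals (`exists_weights`). -/

/-! ### Estimates from the modulus of continuity of the gradient -/

/-- A mean value estimate for a function whose derivative is at most `C * n` on `[0, n]`. -/
theorem abs_le_of_abs_deriv_le_nat {ρ ρ' : ℝ → ℝ} {L C : ℝ} (hL : 0 ≤ L) (hC : 0 ≤ C)
    (h0 : ρ 0 = 0) (hd : ∀ t ∈ Set.Icc 0 L, HasDerivWithinAt ρ (ρ' t) (Set.Icc 0 L) t)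
    (hb : ∀ t ∈ Set.Icc 0 L, ∀ n : ℕ, t ≤ n → |ρ' t| ≤ C * n) :
    |ρ L| ≤ C * (L ^ 2 / 2 + L / 2 + 1 / 8) := by
  have step : ∀ (n : ℕ) (t : ℝ), (n : ℝ) ≤ t → t ≤ n + 1 → t ≤ L →
      |ρ t - ρ n| ≤ C * (n + 1) * (t - n) := by
    intro n t h1 h2 h3
    have hn : (0 : ℝ) ≤ n := n.cast_nonneg
    have hsub : Set.Icc (n : ℝ) t ⊆ Set.Icc 0 L := Set.Icc_subset_Icc hn h3
    have := (convex_Icc (n : ℝ) t).norm_image_sub_le_of_norm_hasDerivWithin_le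
      (f := ρ) (f' := ρ') (C := C * (n + 1))
      (fun s hs => (hd s (hsub hs)).mono hsub)
      (fun s hs => by
        have := hb s (hsub hs) (n + 1) (by push_cast; linarith [hs.2])
        push_cast at this
        exact this)
      (Set.left_mem_Icc.2 h1) (Set.right_mem_Icc.2 h1)
    rwa [Real.norm_eq_abs, Real.norm_eq_abs, abs_of_nonneg (sub_nonneg.2 h1)] at this
  have hnat : ∀ n : ℕ, (n : ℝ) ≤ L → |ρ n| ≤ C * (n * (n + 1) / 2) := by
    intro n
    induction n with
    | zero => intro _; simp [h0]
    | succ n ih =>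
      intro hn
      push_cast at hn ⊢
      have h1 := ih (by linarith)
      have h2 := step n (n + 1) (by linarith) le_rfl hn
      have h3 := abs_add_le (ρ (n + 1) - ρ n) (ρ n)
      rw [sub_add_cancel] at h3
      linarith
  have hfl := Nat.floor_le hL
  have h1 := hnat _ hfl
  have h2 := step _ L hfl (Nat.lt_floor_add_one L).le le_rfl
  have h3 := abs_add_le (ρ L - ρ (⌊L⌋₊ : ℝ)) (ρ (⌊L⌋₊ : ℝ))
  rw [sub_add_cancel] at h3
  -- With `N = ⌊L⌋`, the accumulated bound `N(N+1)/2 + (N+1)(L-N)` falls short of `L²/2 + L/2 + 1/8`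
  -- by exactly `(L-N-1/2)²/2`.
  have h4 := mul_nonneg hC (sq_nonneg (L - ⌊L⌋₊ - 1 / 2))
  linarith

/-- The partial derivatives `fx`, `fy` of a function on a convex set vary by at most `W` over
distances at most `η`. -/
structure GradientBound (Ω : Set (ℝ × ℝ)) (f fx fy : ℝ × ℝ → ℝ) (η W : ℝ) : Prop where
  convex : Convex ℝ Ω
  pos : 0 < η
  nonneg : 0 ≤ W
  hasDeriv : ∀ A ∈ Ω, ∀ B ∈ Ω, ∀ θ ∈ Set.Icc (0 : ℝ) 1,
    HasDerivWithinAt (fun t : ℝ => f (A + t • (B - A)))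
      ((B.1 - A.1) * fx (A + θ • (B - A)) + (B.2 - A.2) * fy (A + θ • (B - A))) (Set.Icc 0 1) θ
  boundX : ∀ A ∈ Ω, ∀ B ∈ Ω, (A.1 - B.1) ^ 2 + (A.2 - B.2) ^ 2 ≤ η ^ 2 → |fx A - fx B| ≤ W
  boundY : ∀ A ∈ Ω, ∀ B ∈ Ω, (A.1 - B.1) ^ 2 + (A.2 - B.2) ^ 2 ≤ η ^ 2 → |fy A - fy B| ≤ W

theorem eq_of_sq_add_sq_le_zero {A B : ℝ × ℝ} (h : (A.1 - B.1) ^ 2 + (A.2 - B.2) ^ 2 ≤ 0) :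
    A = B := by
  have h1 : (A.1 - B.1) ^ 2 = 0 := by linarith [sq_nonneg (A.1 - B.1), sq_nonneg (A.2 - B.2)]
  have h2 : (A.2 - B.2) ^ 2 = 0 := by linarith [sq_nonneg (A.1 - B.1), sq_nonneg (A.2 - B.2)]
  rw [sq_eq_zero_iff, sub_eq_zero] at h1 h2
  exact Prod.ext h1 h2

/-- A bound for the variation over distances at most `η` gives one over distances at most
`n * η`. -/
theorem abs_sub_le_nat_mul {Ω : Set (ℝ × ℝ)} (hΩ : Convex ℝ Ω) {ψ : ℝ × ℝ → ℝ} {η W : ℝ}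
    (hψ : ∀ A ∈ Ω, ∀ B ∈ Ω, (A.1 - B.1) ^ 2 + (A.2 - B.2) ^ 2 ≤ η ^ 2 → |ψ A - ψ B| ≤ W)
    (n : ℕ) : ∀ A ∈ Ω, ∀ B ∈ Ω, (A.1 - B.1) ^ 2 + (A.2 - B.2) ^ 2 ≤ (n * η) ^ 2 →
      |ψ A - ψ B| ≤ n * W := by
  induction n with
  | zero =>
    intro A _ B _ h
    have : A = B := eq_of_sq_add_sq_le_zero (by simpa using h)
    simp [this]
  | succ n ih =>
    intro A hA B hB h
    push_cast at h ⊢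
    have hn : (0 : ℝ) < n + 1 := by positivity
    -- This cuts the segment into a piece of length at most `n * η` and one of length at most `η`.
    set θ : ℝ := n / (n + 1) with hθ
    have e1 : θ * (n + 1) = n := by rw [hθ]; field_simp
    have e2 : (1 - θ) * (n + 1) = 1 := by linarith
    have hθ0 : 0 ≤ θ := by positivity
    have hθ1 : θ ≤ 1 := by
      by_contra hlt
      nlinarith
    have hC : A + θ • (B - A) ∈ Ω := hΩ.add_smul_sub_mem hA hB ⟨hθ0, hθ1⟩
    have h1 := ih A hA _ hC (by
      have := mul_le_mul_of_nonneg_left h (sq_nonneg θ)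
      have e : θ ^ 2 * ((n + 1) * η) ^ 2 = (n * η) ^ 2 := by
        calc θ ^ 2 * ((n + 1) * η) ^ 2 = (θ * (n + 1)) ^ 2 * η ^ 2 := by ring
          _ = (n * η) ^ 2 := by rw [e1]; ring
      rw [e] at this
      refine le_of_eq_of_le ?_ this
      simp; ring)
    have h2 := hψ _ hC B hB (by
      have := mul_le_mul_of_nonneg_left h (sq_nonneg (1 - θ))
      have e : (1 - θ) ^ 2 * ((n + 1) * η) ^ 2 = η ^ 2 := by
        calc (1 - θ) ^ 2 * ((n + 1) * η) ^ 2 = ((1 - θ) * (n + 1)) ^ 2 * η ^ 2 := by ring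
          _ = η ^ 2 := by rw [e2]; ring
      rw [e] at this
      refine le_of_eq_of_le ?_ this
      simp; ring)
    have h3 := abs_sub_le (ψ A) (ψ (A + θ • (B - A))) (ψ B)
    linarith

namespace GradientBound

variable {Ω : Set (ℝ × ℝ)} {f fx fy : ℝ × ℝ → ℝ} {η W : ℝ}

/-- Taylor's formula of first order with a remainder in terms of the modulus of continuity of the
gradient. -/
theorem taylor (hf : GradientBound Ω f fx fy η W) {P M : ℝ × ℝ} (hP : P ∈ Ω) (hM : M ∈ Ω) :
    |f M - f P - fx P * (M.1 - P.1) - fy P * (M.2 - P.2)|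
      ≤ W * (((M.1 - P.1) ^ 2 + (M.2 - P.2) ^ 2) / η + 3 / 4 * η) := by
  have hη := hf.pos
  have hW := hf.nonneg
  set D : ℝ := (M.1 - P.1) ^ 2 + (M.2 - P.2) ^ 2 with hD
  rcases eq_or_lt_of_le (show 0 ≤ D by positivity) with h0 | hpos
  · have hMP : M = P := eq_of_sq_add_sq_le_zero h0.ge
    rw [← h0]
    simp only [hMP, sub_self, mul_zero, abs_zero, zero_div, zero_add]
    positivity
  set l : ℝ := Real.sqrt D with hl
  have hl0 : 0 < l := Real.sqrt_pos.2 hpos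
  have hl2 : l ^ 2 = D := Real.sq_sqrt hpos.le
  set L : ℝ := l / η with hLdef
  have hL0 : 0 < L := by positivity
  have hLη : L * η = l := by rw [hLdef]; field_simp
  -- The rational `3/2` replaces the sharp factor `√2`; the final constants leave room for it.
  have hsum : |M.1 - P.1| + |M.2 - P.2| ≤ 3 / 2 * l := by
    refine abs_le_of_sq_le_sq' ?_ (by positivity) |>.2
    rw [mul_pow, hl2, hD, ← sq_abs (M.1 - P.1), ← sq_abs (M.2 - P.2)]
    nlinarith [sq_nonneg (|M.1 - P.1| - |M.2 - P.2|), sq_nonneg (|M.1 - P.1|),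
      sq_nonneg (|M.2 - P.2|)]
  have hmem : ∀ t ∈ Set.Icc 0 L, t / L ∈ Set.Icc (0 : ℝ) 1 := fun t ht =>
    ⟨div_nonneg ht.1 hL0.le, (div_le_one hL0).2 ht.2⟩
  -- The segment is parametrized by arc length in units of `η`, so that at parameter `t ≤ n` the
  -- gradient has moved by at most `n * W`.
  have key := abs_le_of_abs_deriv_le_nat (L := L) (C := 3 / 2 * η * W)
    (ρ := fun t => f (P + (t / L) • (M - P)) - f P
      - (t / L) * (fx P * (M.1 - P.1) + fy P * (M.2 - P.2)))
    (ρ' := fun t => ((M.1 - P.1) * fx (P + (t / L) • (M - P))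
      + (M.2 - P.2) * fy (P + (t / L) • (M - P))) * (1 / L)
      - (1 / L) * (fx P * (M.1 - P.1) + fy P * (M.2 - P.2)))
    hL0.le (by positivity) (by simp)
    (fun t ht => by
      have hdiv : HasDerivWithinAt (fun t : ℝ => t / L) (1 / L) (Set.Icc 0 L) t :=
        ((hasDerivAt_id t).div_const L).hasDerivWithinAt
      have h1 := (hf.hasDeriv P hP M hM (t / L) (hmem t ht)).comp t hdiv hmem
      exact (h1.sub_const (f P)).sub (hdiv.mul_const _))
    (fun t ht n hn => by
      have hC := hf.convex.add_smul_sub_mem hP hM (hmem t ht)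
      have hdist : ((P + (t / L) • (M - P)).1 - P.1) ^ 2 + ((P + (t / L) • (M - P)).2 - P.2) ^ 2
          ≤ (n * η) ^ 2 := by
        have e : ((P + (t / L) • (M - P)).1 - P.1) ^ 2 + ((P + (t / L) • (M - P)).2 - P.2) ^ 2
            = (t * η) ^ 2 := by
          have : t * η = t / L * l := by rw [← hLη]; field_simp
          rw [this, mul_pow, hl2, hD]
          simp; ring
        rw [e]
        exact pow_le_pow_left₀ (mul_nonneg ht.1 hη.le) (mul_le_mul_of_nonneg_right hn hη.le) 2
      have hx := abs_sub_le_nat_mul hf.convex hf.boundX n _ hC P hP hdist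
      have hy := abs_sub_le_nat_mul hf.convex hf.boundY n _ hC P hP hdist
      set C := P + (t / L) • (M - P)
      have hnW : 0 ≤ n * W := mul_nonneg n.cast_nonneg hW
      calc |((M.1 - P.1) * fx C + (M.2 - P.2) * fy C) * (1 / L)
            - (1 / L) * (fx P * (M.1 - P.1) + fy P * (M.2 - P.2))|
          = |(M.1 - P.1) * (fx C - fx P) + (M.2 - P.2) * (fy C - fy P)| / L := by
            rw [← abs_of_pos hL0, ← abs_div, abs_of_pos hL0]
            congr 1
            ring
        _ ≤ (|M.1 - P.1| * (n * W) + |M.2 - P.2| * (n * W)) / L := by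
            gcongr
            refine (abs_add_le _ _).trans ?_
            rw [abs_mul, abs_mul]
            gcongr
        _ ≤ 3 / 2 * l * (n * W) / L := by
            gcongr
            rw [← add_mul]
            gcongr
        _ = 3 / 2 * η * W * n := by rw [← hLη]; field_simp)
  have hone : L / L = 1 := div_self hL0.ne'
  simp only [hone, one_smul, one_mul, add_sub_cancel] at key
  have e1 : f M - f P - fx P * (M.1 - P.1) - fy P * (M.2 - P.2)
      = f M - f P - (fx P * (M.1 - P.1) + fy P * (M.2 - P.2)) := by ring
  rw [e1]
  refine key.trans ?_
  have e2 : D / η = L ^ 2 * η := by rw [← hl2, ← hLη]; field_simp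
  rw [e2]
  -- The linear term is absorbed: `L² + 3/4` exceeds `3/2 * (L²/2 + L/2 + 1/8)` by `(L - 3/2)²/4`.
  have h5 := mul_nonneg (mul_nonneg hη.le hW) (sq_nonneg (L - 3 / 2))
  nlinarith [h5]

/-- Two segments of the same direction are traversed with speeds `p`, `q`; the increments of `f`
are compared. -/
theorem abs_increments_le (hf : GradientBound Ω f fx fy η W) {A B A' B' : ℝ × ℝ}
    (hA : A ∈ Ω) (hB : B ∈ Ω) (hA' : A' ∈ Ω) (hB' : B' ∈ Ω) {α β e₁ e₂ : ℝ}
    (h11 : α * (B.1 - A.1) = e₁) (h12 : α * (B.2 - A.2) = e₂)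
    (h21 : β * (B'.1 - A'.1) = e₁) (h22 : β * (B'.2 - A'.2) = e₂) (n : ℕ)
    (hA2 : (A.1 - A'.1) ^ 2 + (A.2 - A'.2) ^ 2 ≤ (n * η) ^ 2)
    (hB2 : (B.1 - B'.1) ^ 2 + (B.2 - B'.2) ^ 2 ≤ (n * η) ^ 2) :
    |α * (f B - f A) - β * (f B' - f A')| ≤ (|e₁| + |e₂|) * (n * W) := by
  have hnW : 0 ≤ n * W := mul_nonneg n.cast_nonneg hf.nonneg
  have := (convex_Icc (0 : ℝ) 1).norm_image_sub_le_of_norm_hasDerivWithin_le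
      (f := fun t : ℝ => α * f (A + t • (B - A)) - β * f (A' + t • (B' - A')))
      (f' := fun t : ℝ =>
        α * ((B.1 - A.1) * fx (A + t • (B - A)) + (B.2 - A.2) * fy (A + t • (B - A)))
        - β * ((B'.1 - A'.1) * fx (A' + t • (B' - A')) + (B'.2 - A'.2) * fy (A' + t • (B' - A'))))
      (C := (|e₁| + |e₂|) * (n * W)) (x := 0) (y := 1)
      (fun t ht => ((hf.hasDeriv A hA B hB t ht).const_mul α).sub
        ((hf.hasDeriv A' hA' B' hB' t ht).const_mul β))
      (fun t ht => by
        have hC := hf.convex.add_smul_sub_mem hA hB ht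
        have hC' := hf.convex.add_smul_sub_mem hA' hB' ht
        have hdist : ((A + t • (B - A)).1 - (A' + t • (B' - A')).1) ^ 2
            + ((A + t • (B - A)).2 - (A' + t • (B' - A')).2) ^ 2 ≤ (n * η) ^ 2 := by
          -- Convexity of the squared norm: points at equal parameters are no farther apart than the
          -- endpoints allow. The defect is `t(1-t)` times a squared norm, which is `h3`.
          have h1 := mul_le_mul_of_nonneg_left hA2 (sub_nonneg.2 ht.2)
          have h2 := mul_le_mul_of_nonneg_left hB2 ht.1
          have h3 := mul_nonneg (mul_nonneg ht.1 (sub_nonneg.2 ht.2))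
            (add_nonneg (sq_nonneg ((A.1 - A'.1) - (B.1 - B'.1)))
              (sq_nonneg ((A.2 - A'.2) - (B.2 - B'.2))))
          simp only [Prod.fst_add, Prod.snd_add, Prod.smul_fst, Prod.smul_snd, Prod.fst_sub,
            Prod.snd_sub, smul_eq_mul]
          linarith
        have hx := abs_sub_le_nat_mul hf.convex hf.boundX n _ hC _ hC' hdist
        have hy := abs_sub_le_nat_mul hf.convex hf.boundY n _ hC _ hC' hdist
        rw [Real.norm_eq_abs]
        set C := A + t • (B - A)
        set C' := A' + t • (B' - A')
        have e : α * ((B.1 - A.1) * fx C + (B.2 - A.2) * fy C)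
            - β * ((B'.1 - A'.1) * fx C' + (B'.2 - A'.2) * fy C')
            = e₁ * (fx C - fx C') + e₂ * (fy C - fy C') := by
          linear_combination fx C * h11 + fy C * h12 - fx C' * h21 - fy C' * h22
        rw [e, add_mul]
        refine (abs_add_le _ _).trans ?_
        rw [abs_mul, abs_mul]
        gcongr)
      (Set.left_mem_Icc.2 zero_le_one) (Set.right_mem_Icc.2 zero_le_one)
  simp only [one_smul, zero_smul, add_zero, add_sub_cancel, sub_zero, norm_one, mul_one,
    Real.norm_eq_abs] at this
  refine le_of_eq_of_le ?_ this
  congr 1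
  ring

/-- The symmetric second difference is bounded by the modulus of continuity of the gradient. -/
theorem abs_midpoint_sub_le (hf : GradientBound Ω f fx fy η W) {A M B : ℝ × ℝ}
    (hA : A ∈ Ω) (hM : M ∈ Ω) (hB : B ∈ Ω) (h1 : M.1 - A.1 = B.1 - M.1)
    (h2 : M.2 - A.2 = B.2 - M.2) (hd : (A.1 - M.1) ^ 2 + (A.2 - M.2) ^ 2 ≤ η ^ 2) :
    |2 * f M - f A - f B| ≤ (|B.1 - M.1| + |B.2 - M.2|) * W := by
  have := hf.abs_increments_le hA hM hM hB (α := 1) (β := 1) (e₁ := B.1 - M.1)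
    (e₂ := B.2 - M.2) (by rw [one_mul, h1]) (by rw [one_mul, h2]) (one_mul _) (one_mul _) 1
    (by simpa using hd) (by
      have e : (M.1 - B.1) ^ 2 + (M.2 - B.2) ^ 2 = (A.1 - M.1) ^ 2 + (A.2 - M.2) ^ 2 := by
        linear_combination (- (M.1 - A.1) - (B.1 - M.1)) * h1
          + (- (M.2 - A.2) - (B.2 - M.2)) * h2
      rw [e]; simpa using hd)
  simp only [Nat.cast_one, one_mul] at this
  refine le_of_eq_of_le ?_ this
  congr 1
  ring

end GradientBound

/-! ### Knots, univariate quadratic splines and their moments -/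

namespace Knots

variable {a b : ℝ} (X : Knots a b)

theorem step_pos {i : ℕ} (h1 : 1 ≤ i) (h2 : i ≤ X.m) : 0 < X.step i := by
  obtain ⟨k, rfl⟩ : ∃ k, i = k + 1 := ⟨i - 1, by omega⟩
  have := X.x_lt k (by omega)
  simp only [step, knot, Nat.add_sub_cancel]
  rw [min_eq_left h2, min_eq_left (by omega)]
  linarith

theorem step_zero : X.step 0 = 0 := by simp [step]

theorem step_of_lt {i : ℕ} (h : X.m < i) : X.step i = 0 := by
  simp only [step, knot]
  rw [min_eq_right (by omega), min_eq_right (by omega), sub_self]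

theorem step_nonneg (i : ℕ) : 0 ≤ X.step i := by
  rcases Nat.eq_zero_or_pos i with rfl | h
  · exact X.step_zero.ge
  · rcases le_or_gt i X.m with h' | h'
    · exact (X.step_pos h h').le
    · exact (X.step_of_lt h').ge

theorem maxStep_pos : 0 < X.maxStep :=
  (X.step_pos le_rfl X.m_pos).trans_le
    (Finset.le_sup' X.step (Finset.mem_Icc.2 ⟨le_rfl, X.m_pos⟩))

theorem step_le_maxStep (i : ℕ) : X.step i ≤ X.maxStep := by
  rcases Nat.eq_zero_or_pos i with rfl | h
  · exact X.step_zero.le.trans X.maxStep_pos.le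
  · rcases le_or_gt i X.m with h' | h'
    · exact Finset.le_sup' X.step (Finset.mem_Icc.2 ⟨h, h'⟩)
    · exact (X.step_of_lt h').le.trans X.maxStep_pos.le

theorem knot_sub_one_le (i : ℕ) : X.knot (i - 1) ≤ X.knot i := by
  have := X.step_nonneg i
  simp only [step] at this
  linarith

theorem knot_mono : Monotone X.knot :=
  monotone_nat_of_le_succ fun n => X.knot_sub_one_le (n + 1)

theorem knot_zero : X.knot 0 = a := by simp [knot, X.x_first]

theorem knot_last : X.knot X.m = b := by simp [knot, X.x_last]

theorem knot_mem (i : ℕ) : X.knot i ∈ Set.Icc a b := by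
  have h1 := X.knot_mono (Nat.zero_le i)
  have h2 := X.knot_mono (min_le_right i X.m)
  have h3 : X.knot (min i X.m) = X.knot i := by simp [knot]
  exact ⟨X.knot_zero.ge.trans h1, (h3.ge.trans h2).trans X.knot_last.le⟩

theorem endpoints_lt {a b : ℝ} (X : Knots a b) : a < b := by
  have h1 := X.step_pos le_rfl X.m_pos
  have h2 := X.knot_mem 1
  simp only [step, Nat.sub_self, X.knot_zero] at h1
  linarith [h2.2]

theorem mid_mem (i : ℕ) : X.mid i ∈ Set.Icc a b := by
  have h1 := X.knot_mem i
  have h2 := X.knot_mem (i - 1)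
  constructor
  · simp only [mid]; linarith [h1.1, h2.1]
  · simp only [mid]; linarith [h1.2, h2.2]

theorem mid_sub_knot (i : ℕ) : X.mid i - X.knot (i - 1) = X.step i / 2 := by
  simp only [mid, step]; ring

theorem knot_sub_mid (i : ℕ) : X.knot i - X.mid i = X.step i / 2 := by
  simp only [mid, step]; ring

theorem mid_succ_sub_mid (i : ℕ) : X.mid (i + 1) - X.mid i = (X.step i + X.step (i + 1)) / 2 := by
  simp only [mid, step, Nat.add_sub_cancel]; ring

theorem step_add_step_pos {p : ℕ} (hp : p ≤ X.m) : 0 < X.step p + X.step (p + 1) := by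
  rcases Nat.eq_zero_or_pos p with rfl | h
  · have := X.step_pos le_rfl X.m_pos
    linarith [X.step_nonneg 0]
  · linarith [X.step_pos h hp, X.step_nonneg (p + 1)]

theorem sigma_succ_mul {p : ℕ} (hp : p ≤ X.m) :
    X.sigma (p + 1) * (X.step p + X.step (p + 1)) = X.step (p + 1) := by
  have := (X.step_add_step_pos hp).ne'
  simp only [sigma, Nat.add_sub_cancel]
  field_simp

theorem sigma'_succ_mul {p : ℕ} (hp : p ≤ X.m) :
    X.sigma' (p + 1) * (X.step p + X.step (p + 1)) = X.step p := by
  have := (X.step_add_step_pos hp).ne'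
  simp only [sigma', Nat.add_sub_cancel]
  field_simp

theorem sigma_nonneg (i : ℕ) : 0 ≤ X.sigma i :=
  div_nonneg (X.step_nonneg _) (add_nonneg (X.step_nonneg _) (X.step_nonneg _))

theorem sigma'_nonneg (i : ℕ) : 0 ≤ X.sigma' i :=
  div_nonneg (X.step_nonneg _) (add_nonneg (X.step_nonneg _) (X.step_nonneg _))

theorem sigma_add_sigma' {p : ℕ} (hp : p ≤ X.m) : X.sigma (p + 1) + X.sigma' (p + 1) = 1 := by
  have h := X.step_add_step_pos hp
  have h1 := X.sigma_succ_mul hp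
  have h2 := X.sigma'_succ_mul hp
  refine mul_right_cancel₀ h.ne' ?_
  rw [add_mul, h1, h2]; ring

theorem sigma_mul_step {p : ℕ} (hp : p ≤ X.m) :
    X.sigma (p + 1) * X.step p = X.sigma' (p + 1) * X.step (p + 1) := by
  have h1 := X.sigma_succ_mul hp
  have h2 := X.sigma_add_sigma' hp
  linear_combination h1 - X.step (p + 1) * h2

/-- The weights of the two neighbours balance, so `S₂` adds to the point evaluation a second
difference that annihilates affine functions. With `κ = σ_i σ'_{i+1} / (σ_i + σ'_{i+1})`, both
products equal `-κ h_i / 2`, and `κ ≤ 1/2` because `σ_i, σ'_{i+1} ≤ 1`. -/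
theorem coefA_mul_eq_coefC_mul {i : ℕ} (h1 : 1 ≤ i) (h2 : i ≤ X.m) :
    ∃ e : ℝ, |e| ≤ X.step i / 4 ∧ X.coefA i * (X.mid i - X.mid (i - 1)) = e ∧
      X.coefC i * (X.mid (i + 1) - X.mid i) = e := by
  have hs := X.step_pos h1 h2
  obtain ⟨k, rfl⟩ : ∃ k, i = k + 1 := ⟨i - 1, by omega⟩
  have hk : k ≤ X.m := by omega
  have e1 := X.sigma_succ_mul hk
  have e2 := X.sigma'_succ_mul h2
  have s1 := X.sigma_add_sigma' hk
  have s2 := X.sigma_add_sigma' h2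
  have n1 := X.sigma_nonneg (k + 1)
  have n1' := X.sigma'_nonneg (k + 1)
  have n2 := X.sigma_nonneg (k + 1 + 1)
  have n2' := X.sigma'_nonneg (k + 1 + 1)
  have p1 : 0 < X.sigma (k + 1) := by
    refine lt_of_le_of_ne n1 fun h => ?_
    rw [← h, zero_mul] at e1
    exact hs.ne e1
  have p2 : 0 < X.sigma' (k + 1 + 1) := by
    refine lt_of_le_of_ne n2' fun h => ?_
    rw [← h, zero_mul] at e2
    exact hs.ne e2
  simp only [coefA, coefC, if_pos (And.intro h1 h2), Nat.add_sub_cancel, mid_succ_sub_mid]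
  set σ := X.sigma (k + 1)
  set τ := X.sigma' (k + 1 + 1)
  have hpos : 0 < σ + τ := by linarith
  refine ⟨-(σ * τ / (σ + τ) * X.step (k + 1) / 2), ?_, ?_, ?_⟩
  · have hκ : σ * τ / (σ + τ) ≤ 1 / 2 := by
      rw [div_le_iff₀ hpos]
      nlinarith
    have hκ0 : 0 ≤ σ * τ / (σ + τ) := by positivity
    rw [abs_neg, abs_of_nonneg (by positivity)]
    nlinarith
  · calc -(σ ^ 2 * τ) / (σ + τ) * ((X.step k + X.step (k + 1)) / 2)
        = -(σ * τ / (σ + τ) * (σ * (X.step k + X.step (k + 1))) / 2) := by ring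
      _ = _ := by rw [e1]
  · calc -(σ * τ ^ 2) / (σ + τ) * ((X.step (k + 1) + X.step (k + 1 + 1)) / 2)
        = -(σ * τ / (σ + τ) * (τ * (X.step (k + 1) + X.step (k + 1 + 1))) / 2) := by ring
      _ = _ := by rw [e2]

theorem cell_spec {t : ℝ} (ht : t ∈ Set.Icc a b) :
    1 ≤ X.cell t ∧ X.cell t ≤ X.m ∧ X.knot (X.cell t - 1) ≤ t ∧ t ≤ X.knot (X.cell t) := by
  have hx : ∀ i, i ≤ X.m → X.knot i = X.x i := fun i hi => by simp [knot, hi]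
  set k := Nat.findGreatest (fun i => X.x i ≤ t) (X.m - 1) with hk
  have hm := X.m_pos
  have hk1 : k ≤ X.m - 1 := Nat.findGreatest_le _
  have hk2 : X.x k ≤ t :=
    Nat.findGreatest_spec (P := fun i => X.x i ≤ t) (Nat.zero_le (X.m - 1))
      (by rw [X.x_first]; exact ht.1)
  -- The knots not exceeding `t` form an initial segment, so counting them gives one more than the
  -- last index. Stopping at `m - 1` puts `t = b` into the last cell.
  have hcell : X.cell t = k + 1 := by
    rw [cell, ← Finset.card_range (k + 1)]
    congr 1
    ext i
    simp only [Finset.mem_filter, Finset.mem_range]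
    constructor
    · rintro ⟨h1, h2⟩
      exact Nat.lt_succ_of_le (Nat.le_findGreatest (by omega) h2)
    · intro h
      refine ⟨by omega, le_trans ?_ hk2⟩
      rw [← hx i (by omega), ← hx k (by omega)]
      exact X.knot_mono (by omega)
  rw [hcell, Nat.add_sub_cancel]
  refine ⟨by omega, by omega, by rwa [hx k (by omega)], ?_⟩
  rcases Nat.lt_or_ge (k + 1) X.m with h | h
  · by_contra hlt
    have := Nat.findGreatest_is_greatest (P := fun i => X.x i ≤ t) (n := X.m - 1) (k := k + 1)
      (by omega) (by omega)
    rw [hx _ h.le] at hlt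
    exact this (not_le.1 hlt).le
  · have : k + 1 = X.m := by omega
    rw [this, X.knot_last]
    exact ht.2

theorem sum_knotValue (φ : ℕ → ℝ) {p : ℕ} (hp : p ≤ X.m) :
    ∑ i ∈ Finset.range (X.m + 2), φ i * X.knotValue i p
      = X.sigma (p + 1) * φ p + X.sigma' (p + 1) * φ (p + 1) := by
  have : ∀ i, φ i * X.knotValue i p = (if i = p then X.sigma (p + 1) * φ p else 0)
      + (if i = p + 1 then X.sigma' (p + 1) * φ (p + 1) else 0) := by
    intro i
    simp only [knotValue]
    split_ifs with h1 h2 h2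
    · omega
    · subst h1; ring
    · subst h2; ring
    · ring
  simp only [this, Finset.sum_add_distrib, Finset.sum_ite_eq', Finset.mem_range]
  rw [if_pos (by omega), if_pos (by omega)]

theorem sum_midCoef (φ : ℕ → ℝ) {r : ℕ} (hr : r ≤ X.m) :
    ∑ i ∈ Finset.range (X.m + 2), φ i * midCoef i r = φ r := by
  simp only [midCoef, mul_ite, mul_one, mul_zero, Finset.sum_ite_eq', Finset.mem_range]
  rw [if_pos (by omega)]

theorem knotValue_nonneg (i p : ℕ) : 0 ≤ X.knotValue i p := by
  simp only [knotValue]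
  split_ifs
  exacts [X.sigma_nonneg _, X.sigma'_nonneg _, le_rfl]

theorem midCoef_nonneg (i r : ℕ) : 0 ≤ midCoef i r := by
  simp only [midCoef]
  split_ifs <;> norm_num

/-- The value at `t ∈ [a, b]` of the univariate quadratic spline with coefficients `φ`. -/
noncomputable def spline (φ : ℕ → ℝ) (t : ℝ) : ℝ :=
  let r := X.cell t
  let u := (t - X.knot (r - 1)) / X.step r
  (1 - u) ^ 2 * ∑ i ∈ Finset.range (X.m + 2), φ i * X.knotValue i (r - 1)
    + u ^ 2 * ∑ i ∈ Finset.range (X.m + 2), φ i * X.knotValue i r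
    + 2 * u * (1 - u) * ∑ i ∈ Finset.range (X.m + 2), φ i * midCoef i r

theorem local_mem {t : ℝ} (ht : t ∈ Set.Icc a b) :
    (t - X.knot (X.cell t - 1)) / X.step (X.cell t) ∈ Set.Icc (0 : ℝ) 1 := by
  obtain ⟨h1, h2, h3, h4⟩ := X.cell_spec ht
  have hs := X.step_pos h1 h2
  refine ⟨div_nonneg (by linarith) hs.le, (div_le_one hs).2 ?_⟩
  simp only [step]
  linarith

theorem spline_one {t : ℝ} (ht : t ∈ Set.Icc a b) : X.spline (fun _ => 1) t = 1 := by
  obtain ⟨h1, h2, -, -⟩ := X.cell_spec ht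
  simp only [spline]
  rw [X.sum_knotValue _ (by omega), X.sum_knotValue _ h2, X.sum_midCoef _ h2]
  have e1 := X.sigma_add_sigma' (p := X.cell t - 1) (by omega)
  have e2 := X.sigma_add_sigma' h2
  simp only [mul_one, e1, e2]
  ring

/-- The coefficients `s_i` represent the identity: since `σ_{p+1} h_p = σ'_{p+1} h_{p+1}`, the knot
`x_p` is the corresponding average of `s_p` and `s_{p+1}`. -/
theorem spline_mid_sub {t : ℝ} (ht : t ∈ Set.Icc a b) :
    X.spline (fun i => X.mid i - t) t = 0 := by
  obtain ⟨h1, h2, -, -⟩ := X.cell_spec ht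
  have hs := X.step_pos h1 h2
  simp only [spline]
  have key : ∀ p, p ≤ X.m → X.sigma (p + 1) * (X.mid p - t)
      + X.sigma' (p + 1) * (X.mid (p + 1) - t) = X.knot p - t := by
    intro p hp
    have e1 := X.sigma_add_sigma' hp
    have e2 := X.sigma_mul_step hp
    have e3 := X.knot_sub_mid p
    have e4 := X.mid_sub_knot (p + 1)
    rw [Nat.add_sub_cancel] at e4
    linear_combination (X.knot p - t) * e1 - e2 / 2 - X.sigma (p + 1) * e3
      + X.sigma' (p + 1) * e4
  rw [X.sum_knotValue _ (by omega), X.sum_knotValue _ h2, X.sum_midCoef _ h2,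
    key _ (by omega), key _ h2]
  set u := (t - X.knot (X.cell t - 1)) / X.step (X.cell t) with hu
  have hu' : u * X.step (X.cell t) = t - X.knot (X.cell t - 1) := by
    rw [hu]; field_simp
  simp only [mid]
  simp only [step] at hu'
  linear_combination hu'

/-- By polarization (blossoming), these are the coefficients of `x ↦ (x - t)²`, which vanishes at `x
= t`. -/
theorem spline_mul_knot {t : ℝ} (ht : t ∈ Set.Icc a b) :
    X.spline (fun i => (X.knot (i - 1) - t) * (X.knot i - t)) t = 0 := by
  obtain ⟨h1, h2, -, -⟩ := X.cell_spec ht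
  have hs := X.step_pos h1 h2
  simp only [spline]
  have key : ∀ p, p ≤ X.m → X.sigma (p + 1) * ((X.knot (p - 1) - t) * (X.knot p - t))
      + X.sigma' (p + 1) * ((X.knot (p + 1 - 1) - t) * (X.knot (p + 1) - t))
      = (X.knot p - t) ^ 2 := by
    intro p hp
    have e1 := X.sigma_add_sigma' hp
    have e2 := X.sigma_mul_step hp
    simp only [step, Nat.add_sub_cancel] at e2 ⊢
    linear_combination (X.knot p - t) ^ 2 * e1 - (X.knot p - t) * e2
  rw [X.sum_knotValue _ (by omega), X.sum_knotValue _ h2, X.sum_midCoef _ h2,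
    key _ (by omega), key _ h2]
  set u := (t - X.knot (X.cell t - 1)) / X.step (X.cell t) with hu
  have hu' : (1 - u) * (X.knot (X.cell t - 1) - t) + u * (X.knot (X.cell t) - t) = 0 := by
    have : u * X.step (X.cell t) = t - X.knot (X.cell t - 1) := by
      rw [hu]; field_simp
    simp only [step] at this
    linear_combination this
  linear_combination ((1 - u) * (X.knot (X.cell t - 1) - t) + u * (X.knot (X.cell t) - t)) * hu'

theorem spline_mono {φ ψ : ℕ → ℝ} (h : ∀ i, φ i ≤ ψ i) {t : ℝ} (ht : t ∈ Set.Icc a b) :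
    X.spline φ t ≤ X.spline ψ t := by
  have hu := X.local_mem ht
  have h1 : ∀ p, ∑ i ∈ Finset.range (X.m + 2), φ i * X.knotValue i p
      ≤ ∑ i ∈ Finset.range (X.m + 2), ψ i * X.knotValue i p := fun p =>
    Finset.sum_le_sum fun i _ => mul_le_mul_of_nonneg_right (h i) (X.knotValue_nonneg i p)
  have h2 : ∀ p, ∑ i ∈ Finset.range (X.m + 2), φ i * midCoef i p
      ≤ ∑ i ∈ Finset.range (X.m + 2), ψ i * midCoef i p := fun p =>
    Finset.sum_le_sum fun i _ => mul_le_mul_of_nonneg_right (h i) (midCoef_nonneg i p)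
  have hu1 := sub_nonneg.2 hu.2
  have hu0 := hu.1
  simp only [spline]
  exact add_le_add (add_le_add (mul_le_mul_of_nonneg_left (h1 _) (by positivity))
    (mul_le_mul_of_nonneg_left (h1 _) (by positivity)))
    (mul_le_mul_of_nonneg_left (h2 _) (by positivity))

/-- Each `(s_i - t)²` exceeds `(x_{i-1} - t)(x_i - t)` by `h_i²/4`, and the products contribute
nothing by `spline_mul_knot`. -/
theorem spline_mid_sub_sq_le {t : ℝ} (ht : t ∈ Set.Icc a b) {h : ℝ} (hh : X.maxStep ≤ h) :
    X.spline (fun i => (X.mid i - t) ^ 2) t ≤ h ^ 2 / 4 := by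
  have h1 : ∀ i, (X.mid i - t) ^ 2 ≤ (X.knot (i - 1) - t) * (X.knot i - t) + h ^ 2 / 4 * 1 := by
    intro i
    have e : (X.mid i - t) ^ 2
        = (X.knot (i - 1) - t) * (X.knot i - t) + X.step i ^ 2 / 4 := by
      simp only [mid, step]; ring
    have := pow_le_pow_left₀ (X.step_nonneg i) ((X.step_le_maxStep i).trans hh) 2
    linarith
  refine (X.spline_mono h1 ht).trans (le_of_eq ?_)
  have e1 := X.spline_mul_knot ht
  have e2 := X.spline_one ht
  simp only [spline] at e1 e2 ⊢
  simp only [add_mul, Finset.sum_add_distrib, mul_assoc, ← Finset.mul_sum] at e1 e2 ⊢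
  linear_combination e1 + h ^ 2 / 4 * e2

end Knots

/-! ### The criss-cross element and reduction to one variable -/

/-- On the unit square, the quadratic element is a combination of the products of the univariate
coefficients with nonnegative weights, whose sums along rows and columns are the univariate
Bernstein polynomials. -/
theorem exists_weights {u v : ℝ} (hu : u ∈ Set.Icc (0 : ℝ) 1) (hv : v ∈ Set.Icc (0 : ℝ) 1) :
    ∃ w₁ w₂ w₃ w₄ w₅ w₆ w₇ w₈ : ℝ,
      (0 ≤ w₁ ∧ 0 ≤ w₂ ∧ 0 ≤ w₃ ∧ 0 ≤ w₄ ∧ 0 ≤ w₅ ∧ 0 ≤ w₆ ∧ 0 ≤ w₇ ∧ 0 ≤ w₈) ∧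
      (w₁ + w₃ + w₇ = (1 - u) ^ 2 ∧ w₂ + w₄ + w₈ = u ^ 2 ∧ w₅ + w₆ = 2 * u * (1 - u)) ∧
      (w₁ + w₂ + w₅ = (1 - v) ^ 2 ∧ w₃ + w₄ + w₆ = v ^ 2 ∧ w₇ + w₈ = 2 * v * (1 - v)) ∧
      ∀ cSW cSE cNW cNE cS cN cW cE : ℝ,
        (if v ≤ u ∧ v ≤ 1 - u then
          bernsteinBezier cSW cSE ((cS + cN + cW + cE) / 4) cS ((cS + cW) / 2) ((cS + cE) / 2)
            (1 - u - v) (u - v) (2 * v)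
        else if u ≤ v ∧ 1 - u ≤ v then
          bernsteinBezier cNW cNE ((cS + cN + cW + cE) / 4) cN ((cN + cW) / 2) ((cN + cE) / 2)
            (v - u) (u + v - 1) (2 * (1 - v))
        else if u ≤ v then
          bernsteinBezier cSW cNW ((cS + cN + cW + cE) / 4) cW ((cS + cW) / 2) ((cN + cW) / 2)
            (1 - u - v) (v - u) (2 * u)
        else
          bernsteinBezier cSE cNE ((cS + cN + cW + cE) / 4) cE ((cS + cE) / 2) ((cN + cE) / 2)
            (u - v) (u + v - 1) (2 * (1 - u))) =
        w₁ * cSW + w₂ * cSE + w₃ * cNW + w₄ * cNE + w₅ * cS + w₆ * cN + w₇ * cW + w₈ * cE := by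
  obtain ⟨hu0, hu1⟩ := hu
  obtain ⟨hv0, hv1⟩ := hv
  have hu1' : 0 ≤ 1 - u := by linarith
  have hv1' : 0 ≤ 1 - v := by linarith
  split_ifs with h1 h2 h3
  · have p1 : 0 ≤ 1 - u - v := by linarith [h1.2]
    have p2 : 0 ≤ u - v := by linarith [h1.1]
    -- The centre coefficient, weighted by `(2v)²`, is shared equally among the four sides, whence
    -- the common summand `v²`; the half-diagonal coefficients split evenly between their two sides.
    refine ⟨(1 - u - v) ^ 2, (u - v) ^ 2, 0, 0,
      v ^ 2 + 2 * (1 - u - v) * (u - v) + 2 * v * (1 - u - v) + 2 * v * (u - v), v ^ 2,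
      v ^ 2 + 2 * v * (1 - u - v), v ^ 2 + 2 * v * (u - v), by
        refine ⟨?_, ?_, ?_, ?_, ?_, ?_, ?_, ?_⟩ <;> positivity, ?_, ?_, ?_⟩
    · refine ⟨?_, ?_, ?_⟩ <;> ring
    · refine ⟨?_, ?_, ?_⟩ <;> ring
    · intros; simp only [bernsteinBezier]; ring
  · have p1 : 0 ≤ v - u := by linarith [h2.1]
    have p2 : 0 ≤ u + v - 1 := by linarith [h2.2]
    refine ⟨0, 0, (v - u) ^ 2, (u + v - 1) ^ 2, (1 - v) ^ 2,
      (1 - v) ^ 2 + 2 * (v - u) * (u + v - 1) + 2 * (1 - v) * (v - u) + 2 * (1 - v) * (u + v - 1),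
      (1 - v) ^ 2 + 2 * (1 - v) * (v - u), (1 - v) ^ 2 + 2 * (1 - v) * (u + v - 1), by
        refine ⟨?_, ?_, ?_, ?_, ?_, ?_, ?_, ?_⟩ <;> positivity, ?_, ?_, ?_⟩
    · refine ⟨?_, ?_, ?_⟩ <;> ring
    · refine ⟨?_, ?_, ?_⟩ <;> ring
    · intros; simp only [bernsteinBezier]; ring
  · have p1 : 0 ≤ v - u := by linarith
    have p2 : 0 ≤ 1 - u - v := by
      by_contra h
      exact h2 ⟨h3, by linarith⟩
    refine ⟨(1 - u - v) ^ 2, 0, (v - u) ^ 2, 0, u ^ 2 + 2 * u * (1 - u - v),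
      u ^ 2 + 2 * u * (v - u),
      u ^ 2 + 2 * (1 - u - v) * (v - u) + 2 * u * (1 - u - v) + 2 * u * (v - u), u ^ 2, by
        refine ⟨?_, ?_, ?_, ?_, ?_, ?_, ?_, ?_⟩ <;> positivity, ?_, ?_, ?_⟩
    · refine ⟨?_, ?_, ?_⟩ <;> ring
    · refine ⟨?_, ?_, ?_⟩ <;> ring
    · intros; simp only [bernsteinBezier]; ring
  · have p1 : 0 ≤ u - v := by linarith
    have p2 : 0 ≤ u + v - 1 := by
      by_contra h
      exact h1 ⟨by linarith, by linarith⟩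
    refine ⟨0, (u - v) ^ 2, 0, (u + v - 1) ^ 2, (1 - u) ^ 2 + 2 * (1 - u) * (u - v),
      (1 - u) ^ 2 + 2 * (1 - u) * (u + v - 1), (1 - u) ^ 2,
      (1 - u) ^ 2 + 2 * (u - v) * (u + v - 1) + 2 * (1 - u) * (u - v)
        + 2 * (1 - u) * (u + v - 1), by
        refine ⟨?_, ?_, ?_, ?_, ?_, ?_, ?_, ?_⟩ <;> positivity, ?_, ?_, ?_⟩
    · refine ⟨?_, ?_, ?_⟩ <;> ring
    · refine ⟨?_, ?_, ?_⟩ <;> ring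
    · intros; simp only [bernsteinBezier]; ring

section Spline

variable {a b c d : ℝ} (X : Knots a b) (Y : Knots c d)

/-- Positivity lets termwise bounds on coefficients pass to the spline with no loss from a Lebesgue
constant. -/
theorem bspline_nonneg (i j : ℕ) {P : ℝ × ℝ} (hP : P ∈ rect a b c d) :
    0 ≤ bspline X Y i j P := by
  obtain ⟨w₁, w₂, w₃, w₄, w₅, w₆, w₇, w₈, ⟨n1, n2, n3, n4, n5, n6, n7, n8⟩, -, -, h⟩ :=
    exists_weights (X.local_mem hP.1) (Y.local_mem hP.2)
  simp only [bspline]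
  rw [h]
  have hX := X.knotValue_nonneg i
  have hY := Y.knotValue_nonneg j
  have mX := Knots.midCoef_nonneg i
  have mY := Knots.midCoef_nonneg j
  have key : ∀ {w s t : ℝ}, 0 ≤ w → 0 ≤ s → 0 ≤ t → 0 ≤ w * (s * t) :=
    fun h1 h2 h3 => mul_nonneg h1 (mul_nonneg h2 h3)
  have := key n1 (hX (X.cell P.1 - 1)) (hY (Y.cell P.2 - 1))
  have := key n2 (hX (X.cell P.1)) (hY (Y.cell P.2 - 1))
  have := key n3 (hX (X.cell P.1 - 1)) (hY (Y.cell P.2))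
  have := key n4 (hX (X.cell P.1)) (hY (Y.cell P.2))
  have := key n5 (mX (X.cell P.1)) (hY (Y.cell P.2 - 1))
  have := key n6 (mX (X.cell P.1)) (hY (Y.cell P.2))
  have := key n7 (hX (X.cell P.1 - 1)) (mY (Y.cell P.2))
  have := key n8 (hX (X.cell P.1)) (mY (Y.cell P.2))
  linarith

/-- Bivariate splines whose coefficients depend on the first index only are univariate. -/
theorem sum_bspline_left (φ : ℕ → ℝ) {P : ℝ × ℝ} (hP : P ∈ rect a b c d) :
    ∑ i ∈ Finset.range (X.m + 2), ∑ j ∈ Finset.range (Y.m + 2), φ i * bspline X Y i j P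
      = X.spline φ P.1 := by
  obtain ⟨w₁, w₂, w₃, w₄, w₅, w₆, w₇, w₈, -, ⟨e1, e2, e3⟩, -, h⟩ :=
    exists_weights (X.local_mem hP.1) (Y.local_mem hP.2)
  obtain ⟨h1, h2, -, -⟩ := Y.cell_spec hP.2
  have s1 := Y.sum_knotValue (fun _ => 1) (p := Y.cell P.2 - 1) (by omega)
  have s2 := Y.sum_knotValue (fun _ => 1) h2
  have s3 := Y.sum_midCoef (fun _ => 1) h2
  simp only [mul_one, one_mul, Y.sigma_add_sigma' h2,
    Y.sigma_add_sigma' (p := Y.cell P.2 - 1) (by omega)] at s1 s2 s3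
  simp only [bspline, h, Knots.spline, ← e1, ← e2, ← e3, Finset.mul_sum,
    ← Finset.sum_add_distrib]
  refine Finset.sum_congr rfl fun i _ => ?_
  simp only [mul_add, Finset.sum_add_distrib, ← mul_assoc, ← Finset.mul_sum, s1, s2, s3]
  ring

/-- Bivariate splines whose coefficients depend on the second index only are univariate. -/
theorem sum_bspline_right (φ : ℕ → ℝ) {P : ℝ × ℝ} (hP : P ∈ rect a b c d) :
    ∑ i ∈ Finset.range (X.m + 2), ∑ j ∈ Finset.range (Y.m + 2), φ j * bspline X Y i j P
      = Y.spline φ P.2 := by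
  obtain ⟨w₁, w₂, w₃, w₄, w₅, w₆, w₇, w₈, -, -, ⟨e1, e2, e3⟩, h⟩ :=
    exists_weights (X.local_mem hP.1) (Y.local_mem hP.2)
  obtain ⟨h1, h2, -, -⟩ := X.cell_spec hP.1
  have s1 := X.sum_knotValue (fun _ => 1) (p := X.cell P.1 - 1) (by omega)
  have s2 := X.sum_knotValue (fun _ => 1) h2
  have s3 := X.sum_midCoef (fun _ => 1) h2
  simp only [mul_one, one_mul, X.sigma_add_sigma' h2,
    X.sigma_add_sigma' (p := X.cell P.1 - 1) (by omega)] at s1 s2 s3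
  rw [Finset.sum_comm]
  simp only [bspline, h, Knots.spline, ← e1, ← e2, ← e3, Finset.mul_sum,
    ← Finset.sum_add_distrib]
  refine Finset.sum_congr rfl fun j _ => ?_
  simp only [mul_add, Finset.sum_add_distrib, mul_left_comm (φ j), mul_comm _ (φ j),
    ← mul_assoc, ← Finset.sum_mul, ← Finset.mul_sum, s1, s2, s3]
  ring

end Spline

/-! ### From `C¹` functions to gradient bounds -/

theorem convex_rect (a b c d : ℝ) : Convex ℝ (rect a b c d) :=
  (convex_Icc a b).prod (convex_Icc c d)

theorem abs_sub_le_modulus {Ω : Set (ℝ × ℝ)} (hΩ : IsCompact Ω) {ψ : ℝ × ℝ → ℝ}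
    (hψ : ContinuousOn ψ Ω) {η : ℝ} (hη : 0 ≤ η) {A B : ℝ × ℝ} (hA : A ∈ Ω) (hB : B ∈ Ω)
    (h : (A.1 - B.1) ^ 2 + (A.2 - B.2) ^ 2 ≤ η ^ 2) : |ψ A - ψ B| ≤ modulus Ω ψ η := by
  refine le_csSup ?_ ⟨A, hA, B, hB, Real.sqrt_le_iff.2 ⟨hη, h⟩, rfl⟩
  -- Without boundedness the `sSup` in `modulus` would be a default value and bound nothing.
  obtain ⟨C, hC⟩ := hΩ.exists_bound_of_continuousOn hψ
  refine ⟨C + C, ?_⟩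
  rintro w ⟨M, hM, P, hP, -, rfl⟩
  exact (abs_sub _ _).trans (add_le_add (hC M hM) (hC P hP))

theorem gradientBound_of_contDiffOn {a b c d : ℝ} (hab : a < b) (hcd : c < d) {f : ℝ × ℝ → ℝ}
    (hf : ContDiffOn ℝ 1 f (rect a b c d)) {η : ℝ} (hη : 0 < η) :
    GradientBound (rect a b c d) f (fun P => fderivWithin ℝ f (rect a b c d) P (1, 0))
      (fun P => fderivWithin ℝ f (rect a b c d) P (0, 1)) η
      (modulusD (rect a b c d) f η) := by
  have hcpt : IsCompact (rect a b c d) := isCompact_Icc.prod isCompact_Icc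
  have huniq : UniqueDiffOn ℝ (rect a b c d) :=
    (uniqueDiffOn_Icc hab).prod (uniqueDiffOn_Icc hcd)
  have hcont : ContinuousOn (fderivWithin ℝ f (rect a b c d)) (rect a b c d) :=
    hf.continuousOn_fderivWithin huniq le_rfl
  have hx : ∀ A ∈ rect a b c d, ∀ B ∈ rect a b c d,
      (A.1 - B.1) ^ 2 + (A.2 - B.2) ^ 2 ≤ η ^ 2 →
      |fderivWithin ℝ f (rect a b c d) A (1, 0) - fderivWithin ℝ f (rect a b c d) B (1, 0)|
        ≤ modulusD (rect a b c d) f η := fun A hA B hB h =>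
    (abs_sub_le_modulus hcpt (hcont.clm_apply continuousOn_const) hη.le hA hB h).trans
      (le_max_left _ _)
  have hy : ∀ A ∈ rect a b c d, ∀ B ∈ rect a b c d,
      (A.1 - B.1) ^ 2 + (A.2 - B.2) ^ 2 ≤ η ^ 2 →
      |fderivWithin ℝ f (rect a b c d) A (0, 1) - fderivWithin ℝ f (rect a b c d) B (0, 1)|
        ≤ modulusD (rect a b c d) f η := fun A hA B hB h =>
    (abs_sub_le_modulus hcpt (hcont.clm_apply continuousOn_const) hη.le hA hB h).trans
      (le_max_right _ _)
  refine ⟨convex_rect a b c d, hη, ?_, ?_, hx, hy⟩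
  · have hac : (a, c) ∈ rect a b c d := ⟨⟨le_rfl, hab.le⟩, ⟨le_rfl, hcd.le⟩⟩
    exact (abs_nonneg _).trans (hx _ hac _ hac (by simpa using sq_nonneg η))
  · intro A hA B hB θ hθ
    have hmaps : Set.MapsTo (fun t : ℝ => A + t • (B - A)) (Set.Icc 0 1) (rect a b c d) :=
      fun t ht => (convex_rect a b c d).add_smul_sub_mem hA hB ht
    have hline : HasDerivWithinAt (fun t : ℝ => A + t • (B - A)) (B - A) (Set.Icc 0 1) θ := by
      simpa using (((hasDerivAt_id θ).smul_const (B - A)).const_add A).hasDerivWithinAt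
    have hfd := ((hf.differentiableOn one_ne_zero) _ (hmaps hθ)).hasFDerivWithinAt
    have h := hfd.comp_hasDerivWithinAt θ hline hmaps
    refine h.congr_deriv ?_
    have e : B - A = (B.1 - A.1) • ((1 : ℝ), (0 : ℝ)) + (B.2 - A.2) • ((0 : ℝ), (1 : ℝ)) := by
      ext <;> simp
    beta_reduce
    generalize A + θ • (B - A) = C
    rw [e, map_add, map_smul, map_smul, smul_eq_mul, smul_eq_mul]

/-! ### Error of the quasi-interpolants -/

section Spline

variable {a b c d : ℝ} (X : Knots a b) (Y : Knots c d) {f fx fy : ℝ × ℝ → ℝ} {η W : ℝ}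

theorem step_le_of_meshSize (h : meshSize X Y ≤ 2 * η) (i : ℕ) :
    X.step i ≤ 2 * η ∧ Y.step i ≤ 2 * η :=
  ⟨(X.step_le_maxStep i).trans ((le_max_left _ _).trans h),
    (Y.step_le_maxStep i).trans ((le_max_right _ _).trans h)⟩

/-- The error of a quasi-interpolant whose functionals are close to the evaluations at the
midpoints `(s_i, t_j)`. -/
theorem abs_sub_sum_bspline_le (hf : GradientBound (rect a b c d) f fx fy η W)
    (hη : meshSize X Y ≤ 2 * η) {μ : ℕ → ℕ → ℝ} {K : ℝ}
    (hμ : ∀ i j, |μ i j - f (X.mid i, Y.mid j)| ≤ K) {P : ℝ × ℝ} (hP : P ∈ rect a b c d) :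
    |f P - ∑ i ∈ Finset.range (X.m + 2), ∑ j ∈ Finset.range (Y.m + 2),
      μ i j * bspline X Y i j P| ≤ K + 11 / 4 * η * W := by
  have hη0 := hf.pos
  have hW := hf.nonneg
  -- The moments of orders zero, one and two of the B-splines at `P`.
  have t1 := (sum_bspline_left X Y (fun _ => 1) hP).trans (X.spline_one hP.1)
  have tx := (sum_bspline_left X Y _ hP).trans (X.spline_mid_sub hP.1)
  have ty := (sum_bspline_right X Y _ hP).trans (Y.spline_mid_sub hP.2)
  have tx2 := (sum_bspline_left X Y _ hP).trans_le
    (X.spline_mid_sub_sq_le hP.1 ((le_max_left _ _).trans hη))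
  have ty2 := (sum_bspline_right X Y _ hP).trans_le
    (Y.spline_mid_sub_sq_le hP.2 ((le_max_right _ _).trans hη))
  have hterm : ∀ i j, |μ i j - f P - fx P * (X.mid i - P.1) - fy P * (Y.mid j - P.2)|
      ≤ K + W * (((X.mid i - P.1) ^ 2 + (Y.mid j - P.2) ^ 2) / η + 3 / 4 * η) := by
    intro i j
    have h1 := hμ i j
    have h2 := hf.taylor hP (M := (X.mid i, Y.mid j)) ⟨X.mid_mem i, Y.mid_mem j⟩
    have h3 := abs_add_le (μ i j - f (X.mid i, Y.mid j))
      (f (X.mid i, Y.mid j) - f P - fx P * (X.mid i - P.1) - fy P * (Y.mid j - P.2))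
    have e : μ i j - f P - fx P * (X.mid i - P.1) - fy P * (Y.mid j - P.2)
        = (μ i j - f (X.mid i, Y.mid j))
          + (f (X.mid i, Y.mid j) - f P - fx P * (X.mid i - P.1) - fy P * (Y.mid j - P.2)) := by
      ring
    rw [e]
    exact h3.trans (add_le_add h1 h2)
  have hexp : ∑ i ∈ Finset.range (X.m + 2), ∑ j ∈ Finset.range (Y.m + 2),
        μ i j * bspline X Y i j P - f P
      = ∑ i ∈ Finset.range (X.m + 2), ∑ j ∈ Finset.range (Y.m + 2),
        (μ i j - f P - fx P * (X.mid i - P.1) - fy P * (Y.mid j - P.2)) * bspline X Y i j P := by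
    have e : ∑ i ∈ Finset.range (X.m + 2), ∑ j ∈ Finset.range (Y.m + 2),
          μ i j * bspline X Y i j P - f P
        = ∑ i ∈ Finset.range (X.m + 2), ∑ j ∈ Finset.range (Y.m + 2), μ i j * bspline X Y i j P
          - f P * ∑ i ∈ Finset.range (X.m + 2), ∑ j ∈ Finset.range (Y.m + 2),
            1 * bspline X Y i j P
          - fx P * ∑ i ∈ Finset.range (X.m + 2), ∑ j ∈ Finset.range (Y.m + 2),
            (X.mid i - P.1) * bspline X Y i j P
          - fy P * ∑ i ∈ Finset.range (X.m + 2), ∑ j ∈ Finset.range (Y.m + 2),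
            (Y.mid j - P.2) * bspline X Y i j P := by
      rw [t1, tx, ty]
      ring
    rw [e]
    simp only [Finset.mul_sum, ← Finset.sum_sub_distrib]
    refine Finset.sum_congr rfl fun i _ => Finset.sum_congr rfl fun j _ => ?_
    ring
  rw [abs_sub_comm, hexp]
  calc _ ≤ ∑ i ∈ Finset.range (X.m + 2), ∑ j ∈ Finset.range (Y.m + 2),
        (K + W * (((X.mid i - P.1) ^ 2 + (Y.mid j - P.2) ^ 2) / η + 3 / 4 * η))
          * bspline X Y i j P := by
        refine (Finset.abs_sum_le_sum_abs _ _).trans (Finset.sum_le_sum fun i _ =>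
          (Finset.abs_sum_le_sum_abs _ _).trans (Finset.sum_le_sum fun j _ => ?_))
        rw [abs_mul, abs_of_nonneg (bspline_nonneg X Y i j hP)]
        exact mul_le_mul_of_nonneg_right (hterm i j) (bspline_nonneg X Y i j hP)
    _ = (K + W * (3 / 4 * η)) * ∑ i ∈ Finset.range (X.m + 2), ∑ j ∈ Finset.range (Y.m + 2),
          1 * bspline X Y i j P
        + W / η * ((∑ i ∈ Finset.range (X.m + 2), ∑ j ∈ Finset.range (Y.m + 2),
          (X.mid i - P.1) ^ 2 * bspline X Y i j P)
        + ∑ i ∈ Finset.range (X.m + 2), ∑ j ∈ Finset.range (Y.m + 2),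
          (Y.mid j - P.2) ^ 2 * bspline X Y i j P) := by
        simp only [Finset.mul_sum, ← Finset.sum_add_distrib]
        refine Finset.sum_congr rfl fun i _ => Finset.sum_congr rfl fun j _ => ?_
        ring
    _ ≤ (K + W * (3 / 4 * η)) * 1 + W / η * ((2 * η) ^ 2 / 4 + (2 * η) ^ 2 / 4) := by
        rw [t1]
        gcongr
    _ = K + 11 / 4 * η * W := by field_simp; ring

/-- Each direction contributes `ηW`: the balanced increment is at most `h_i/4 ≤ η/2`, and
neighbouring midpoints are at most `2η` apart, where the gradient varies by at most `2W`. -/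
theorem abs_muS_sub_le (hf : GradientBound (rect a b c d) f fx fy η W)
    (hη : meshSize X Y ≤ 2 * η) (i j : ℕ) :
    |muS X Y f i j - f (X.mid i, Y.mid j)| ≤ 2 * η * W := by
  have hη0 := hf.pos
  have hW := hf.nonneg
  have hmem : ∀ i j, (X.mid i, Y.mid j) ∈ rect a b c d := fun i j => ⟨X.mid_mem i, Y.mid_mem j⟩
  have hx : ∀ i, 0 ≤ X.mid (i + 1) - X.mid i ∧ X.mid (i + 1) - X.mid i ≤ 2 * η := by
    intro i
    rw [X.mid_succ_sub_mid]
    constructor <;> linarith [X.step_nonneg i, X.step_nonneg (i + 1),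
      (step_le_of_meshSize X Y hη i).1, (step_le_of_meshSize X Y hη (i + 1)).1]
  have hy : ∀ i, 0 ≤ Y.mid (i + 1) - Y.mid i ∧ Y.mid (i + 1) - Y.mid i ≤ 2 * η := by
    intro i
    rw [Y.mid_succ_sub_mid]
    constructor <;> linarith [Y.step_nonneg i, Y.step_nonneg (i + 1),
      (step_le_of_meshSize X Y hη i).2, (step_le_of_meshSize X Y hη (i + 1)).2]
  have hxx : |X.coefA i * (f (X.mid i, Y.mid j) - f (X.mid (i - 1), Y.mid j))
      - X.coefC i * (f (X.mid (i + 1), Y.mid j) - f (X.mid i, Y.mid j))| ≤ η * W := by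
    by_cases hi : 1 ≤ i ∧ i ≤ X.m
    · obtain ⟨e, he, h1, h2⟩ := X.coefA_mul_eq_coefC_mul hi.1 hi.2
      have := hf.abs_increments_le (hmem (i - 1) j) (hmem i j) (hmem i j) (hmem (i + 1) j)
        (α := X.coefA i) (β := X.coefC i) (e₁ := e) (e₂ := 0) h1 (by simp) h2 (by simp) 2
        (by
          have := hx (i - 1)
          rw [Nat.sub_add_cancel hi.1] at this
          have := pow_le_pow_left₀ this.1 this.2 2
          push_cast
          linarith)
        (by
          have := pow_le_pow_left₀ (hx i).1 (hx i).2 2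
          push_cast
          linarith)
      refine this.trans ?_
      have he2 : |e| ≤ η / 2 := by linarith [(step_le_of_meshSize X Y hη i).1]
      rw [abs_zero, add_zero]
      push_cast
      linarith [mul_le_mul_of_nonneg_right he2 hW]
    · simp only [Knots.coefA, Knots.coefC, if_neg hi, zero_mul, sub_zero, abs_zero]
      positivity
  have hyy : |Y.coefA j * (f (X.mid i, Y.mid j) - f (X.mid i, Y.mid (j - 1)))
      - Y.coefC j * (f (X.mid i, Y.mid (j + 1)) - f (X.mid i, Y.mid j))| ≤ η * W := by
    by_cases hj : 1 ≤ j ∧ j ≤ Y.m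
    · obtain ⟨e, he, h1, h2⟩ := Y.coefA_mul_eq_coefC_mul hj.1 hj.2
      have := hf.abs_increments_le (hmem i (j - 1)) (hmem i j) (hmem i j) (hmem i (j + 1))
        (α := Y.coefA j) (β := Y.coefC j) (e₁ := 0) (e₂ := e) (by simp) h1 (by simp) h2 2
        (by
          have := hy (j - 1)
          rw [Nat.sub_add_cancel hj.1] at this
          have := pow_le_pow_left₀ this.1 this.2 2
          push_cast
          linarith)
        (by
          have := pow_le_pow_left₀ (hy j).1 (hy j).2 2
          push_cast
          linarith)
      refine this.trans ?_
      have he2 : |e| ≤ η / 2 := by linarith [(step_le_of_meshSize X Y hη j).2]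
      rw [abs_zero, zero_add]
      push_cast
      linarith [mul_le_mul_of_nonneg_right he2 hW]
    · simp only [Knots.coefA, Knots.coefC, if_neg hj, zero_mul, sub_zero, abs_zero]
      positivity
  rw [abs_le] at hxx hyy ⊢
  simp only [muS]
  constructor <;> linarith [hxx.1, hxx.2, hyy.1, hyy.2]

/-- The deviation is `f` at the centre of the cell minus its mean over the corners. It splits into
half a horizontal second difference through the centre and a quarter of a vertical one along each of
the two vertical sides. -/
theorem abs_muW_sub_le (hf : GradientBound (rect a b c d) f fx fy η W)
    (hη : meshSize X Y ≤ 2 * η) (i j : ℕ) :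
    |muW X Y f i j - f (X.mid i, Y.mid j)| ≤ η * W := by
  have hη0 := hf.pos
  have hW := hf.nonneg
  have hx := (step_le_of_meshSize X Y hη i).1
  have hy := (step_le_of_meshSize X Y hη j).2
  have hx0 := X.step_nonneg i
  have hy0 := Y.step_nonneg j
  have x1 := X.mid_sub_knot i
  have x2 := X.knot_sub_mid i
  have y1 := Y.mid_sub_knot j
  have y2 := Y.knot_sub_mid j
  have hxx : ∀ y ∈ Set.Icc c d, |2 * f (X.mid i, y) - f (X.knot (i - 1), y) - f (X.knot i, y)|
      ≤ η * W := by
    intro y hy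
    refine (hf.abs_midpoint_sub_le (A := (X.knot (i - 1), y)) (M := (X.mid i, y))
      (B := (X.knot i, y)) ⟨X.knot_mem _, hy⟩ ⟨X.mid_mem _, hy⟩ ⟨X.knot_mem _, hy⟩
      (x1.trans x2.symm) rfl ?_).trans ?_
    · have := pow_le_pow_left₀ (by linarith) (show X.mid i - X.knot (i - 1) ≤ η by linarith) 2
      simp only [sub_self]
      linarith
    · simp only [sub_self, abs_zero, add_zero, x2]
      rw [abs_of_nonneg (by linarith)]
      gcongr
      linarith
  have hyy : ∀ x ∈ Set.Icc a b, |2 * f (x, Y.mid j) - f (x, Y.knot (j - 1)) - f (x, Y.knot j)|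
      ≤ η * W := by
    intro x hx
    refine (hf.abs_midpoint_sub_le (A := (x, Y.knot (j - 1))) (M := (x, Y.mid j))
      (B := (x, Y.knot j)) ⟨hx, Y.knot_mem _⟩ ⟨hx, Y.mid_mem _⟩ ⟨hx, Y.knot_mem _⟩
      rfl (y1.trans y2.symm) ?_).trans ?_
    · have := pow_le_pow_left₀ (by linarith) (show Y.mid j - Y.knot (j - 1) ≤ η by linarith) 2
      simp only [sub_self]
      linarith
    · simp only [sub_self, abs_zero, zero_add, y2]
      rw [abs_of_nonneg (by linarith)]
      gcongr
      linarith
  have h1 := abs_le.1 (hxx _ (Y.mid_mem j))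
  have h2 := abs_le.1 (hyy _ (X.knot_mem (i - 1)))
  have h3 := abs_le.1 (hyy _ (X.knot_mem i))
  rw [abs_le]
  simp only [muW]
  constructor <;> linarith [h1.1, h1.2, h2.1, h2.2, h3.1, h3.2]

end Spline

/-! ### The theorem -/

theorem supNorm_le_of_forall {Ω : Set (ℝ × ℝ)} (hΩ : Ω.Nonempty) {g : ℝ × ℝ → ℝ} {C : ℝ}
    (h : ∀ P ∈ Ω, |g P| ≤ C) :
    BddAbove ((fun P => |g P|) '' Ω) ∧ supNorm Ω g ≤ C := by
  have h' : ∀ w ∈ (fun P => |g P|) '' Ω, w ≤ C := Set.forall_mem_image.2 h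
  exact ⟨⟨C, h'⟩, csSup_le (hΩ.image _) h'⟩

theorem theorem2 :
    (∃ C₁ : ℝ, 0 < C₁ ∧ C₁ ≤ 3 ∧
      ∀ (a b c d : ℝ) (X : Knots a b) (Y : Knots c d) (f : ℝ × ℝ → ℝ),
        ContDiffOn ℝ 1 f (rect a b c d) →
          BddAbove ((fun P => |f P - quasiS X Y f P|) '' rect a b c d) ∧
          supNorm (rect a b c d) (fun P => f P - quasiS X Y f P)
            ≤ C₁ * meshSize X Y * modulusD (rect a b c d) f (meshSize X Y / 2)) ∧
    (∃ C₁ : ℝ, 0 < C₁ ∧ C₁ ≤ 2 ∧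
      ∀ (a b c d : ℝ) (X : Knots a b) (Y : Knots c d) (f : ℝ × ℝ → ℝ),
        ContDiffOn ℝ 1 f (rect a b c d) →
          BddAbove ((fun P => |f P - quasiW X Y f P|) '' rect a b c d) ∧
          supNorm (rect a b c d) (fun P => f P - quasiW X Y f P)
            ≤ C₁ * meshSize X Y * modulusD (rect a b c d) f (meshSize X Y / 2)) := by
  -- With `η = h/2`, the totals `(2 + 11/4) η` and `(1 + 11/4) η` are `19/8 * h` and `15/8 * h`.
  refine ⟨⟨19 / 8, by norm_num, by norm_num, ?_⟩, ⟨15 / 8, by norm_num, by norm_num, ?_⟩⟩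
  all_goals
    intro a b c d X Y f hf
    have hh : 0 < meshSize X Y := X.maxStep_pos.trans_le (le_max_left _ _)
    have hη : meshSize X Y ≤ 2 * (meshSize X Y / 2) := by linarith
    have hG := gradientBound_of_contDiffOn X.endpoints_lt Y.endpoints_lt hf (half_pos hh)
    have hne : (rect a b c d).Nonempty := ⟨(X.mid 0, Y.mid 0), X.mid_mem 0, Y.mid_mem 0⟩
    refine supNorm_le_of_forall hne fun P hP => ?_
  · refine (abs_sub_sum_bspline_le X Y hG hη (abs_muS_sub_le X Y hG hη) hP).trans
      (le_of_eq ?_)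
    ring
  · refine (abs_sub_sum_bspline_le X Y hG hη (abs_muW_sub_le X Y hG hη) hP).trans
      (le_of_eq ?_)
    ring
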